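/- \textbf{Lemma (Compactness with Continuations).} Consider the call-by-value language with types $\tau ::= x \mid 0 \mid 1 \mid \tau\to\tau \mid \tau\times\tau \mid \forall x.\tau \mid \exists x.\tau \mid \mathsf{cont}(\tau)$, terms \begin{align*} e ::=\;& x \mid \mathsf{let}\ x = e\ \mathsf{in}\ e \mid \mathsf{abort}_\tau\, e \mid () \mid \mathsf{fun}\ f\,(x:\tau):\tau.\,e \mid e\,e \mid (e,e) \mid \pi_1 e \mid \pi_2 e \mid \Lambda x.\,e \mid e[\tau] \\ & \mid \mathsf{pack}\,[\tau,e]\ \mathsf{as}\ \exists x.\tau \mid \mathsf{open}\ e\ \mathsf{as}\ [x,y]\ \mathsf{in}\ e \mid \mathsf{letcc}_\tau\, x.\,e \mid \mathsf{throw}\ e\ \mathsf{to}\ e \mid \mathsf{cont}(E) \end{align*} and evaluation contexts \begin{align*} E ::=\;& [\cdot] \mid \mathsf{let}\ x = E\ \mathsf{in}\ e \mid \mathsf{abort}_\tau\, E \mid E\,e \mid e\,E \mid (E,e) \mid (e,E) \mid \pi_1 E \mid \pi_2 E \mid E[\tau] \\ & \mid \mathsf{pack}\,[\tau,E]\ \mathsf{as}\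 \exists x.\tau \mid \mathsf{open}\ E\ \mathsf{as}\ [x,y]\ \mathsf{in}\ e \mid \mathsf{throw}\ E\ \mathsf{to}\ e \mid \mathsf{throw}\ e\ \mathsf{to}\ E . \end{align*} Terms are taken up to renaming of bound variables, and substitution is capture-avoiding. The values are $()$, functions, $\Lambda x.e$, $\mathsf{cont}(E)$, pairs of values, and packages $\mathsf{pack}\,[\tau,v]\ \mathsf{as}\ \exists x.\tau'$ of values $v$. The relation $E; e \longmapsto e'$ (the closed term $e$, inside the closed evaluation context $E$, makes the whole program $E[e]$ step to the program $e'$) is defined inductively. For all values $v, v_1, v_2$ it has the reductions \begin{align*} E;\ \mathsf{let}\ x = v\ \mathsf{in}\ e &\longmapsto E[[v/x]e], & E;\ (\mathsf{fun}\ f\,(x:\tau):\tau'.\,e)\,v &\longmapsto E[[\mathsf{fun}\ f\,(x:\tau):\tau'.\,e/f,\ v/x]e],\\ E;\ \pi_i (v_1,v_2) &\longmapsto E[v_i], & E;\ (\Lambda x.\,e)[\tau] &\longmapsto E[[\tau/x]e],\\ E;\ \mathsf{open}\ (\mathsf{pack}\,[\tau,v]\ \mathsf{as}\ \exists x.\tau')\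 \mathsf{as}\ [x,y]\ \mathsf{in}\ e &\longmapsto E[[\tau/x, v/y]e], & E;\ \mathsf{letcc}_\tau\, x.\,e &\longmapsto E[[\mathsf{cont}(E)/x]e],\\ E;\ \mathsf{throw}\ v\ \mathsf{to}\ \mathsf{cont}(E') &\longmapsto E'[v], && \end{align*} and, for every single-frame context $K$, i.e. one of the productions above other than $[\cdot]$ with $[\cdot]$ in place of its subcontext, the rule that $E; K[e] \longmapsto e'$ whenever $E[K]; e \longmapsto e'$; for the frames $e_1\,[\cdot]$, $(e_1,[\cdot])$ and $\mathsf{throw}\ e_1\ \mathsf{to}\ [\cdot]$ this rule also requires $e_1$ to be a value. A closed term $e$ \emph{terminates}, written $e\downarrow$, if finitely many (possibly zero) steps of the form $[\cdot]; e_1 \longmapsto e_2$ lead from $e$ to a value. Fix a closed function $F_\omega = \mathsf{fun}\ f\,(x:\tau_1):\tau_2.\,e_f$ (no free term or type variables), and define its unrollings by $$F_0 = \mathsf{fun}\ g\,(y:\tau_1):\tau_2.\ g\,y, \qquad F_{n+1} = \mathsf{fun}\ \_\,(y:\tau_1):\tau_2.\ [F_n/f,\ y/x]e_f .$$ Then for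 every closed evaluation context $E$ and every term $e$ without free type variables and with no free term variable other than $x$ (neither of them needs to be well typed), $$E[[F_\omega/x]e]\downarrow \quad\Longleftrightarrow\quad \exists n\in\mathbb{N}.\ E[[F_n/x]e]\downarrow .$$ -/

import Mathlib

/-!
A call-by-value language with recursive functions, products, polymorphic and existential types,
and first-class continuations (`letcc` / `throw` / `cont E`).

Variables are de Bruijn indices and the syntax is well scoped: `Ty m` is the set of types with
(at most) `m` free type variables, `Tm m n` and `ECtx m n` are the terms and the evaluation
contexts with `m` free type variables and `n` free term variables. Hence "closed" means
`Ty 0`, `Tm 0 0`, `ECtx 0 0`. In a binding construct the variable bound last has index `0`.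
-/

namespace ContLang

/-- `τ ::= x | 0 | 1 | τ → τ | τ × τ | ∀x.τ | ∃x.τ | cont τ` -/
inductive Ty : ℕ → Type
  | var {m : ℕ} (i : Fin m) : Ty m
  | zero {m : ℕ} : Ty m
  | one {m : ℕ} : Ty m
  | arr {m : ℕ} (a b : Ty m) : Ty m
  | prod {m : ℕ} (a b : Ty m) : Ty m
  | all {m : ℕ} (a : Ty (m + 1)) : Ty m
  | ex {m : ℕ} (a : Ty (m + 1)) : Ty m
  | cont {m : ℕ} (a : Ty m) : Ty m

mutual

/-- Terms. -/
inductive Tm : ℕ → ℕ → Type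
  /-- a term variable -/
  | var {m n : ℕ} (i : Fin n) : Tm m n
  /-- `let x = e₁ in e₂` -/
  | letIn {m n : ℕ} (e₁ : Tm m n) (e₂ : Tm m (n + 1)) : Tm m n
  /-- `abort[τ] e` -/
  | abort {m n : ℕ} (τ : Ty m) (e : Tm m n) : Tm m n
  /-- `()` -/
  | unit {m n : ℕ} : Tm m n
  /-- `fun f (x : τ₁) : τ₂. e`; in `e`, index `0` is the argument `x` and index `1` is `f` -/
  | fn {m n : ℕ} (τ₁ τ₂ : Ty m) (e : Tm m (n + 2)) : Tm m n
  /-- `e₁ e₂` -/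
  | app {m n : ℕ} (e₁ e₂ : Tm m n) : Tm m n
  /-- `(e₁, e₂)` -/
  | pair {m n : ℕ} (e₁ e₂ : Tm m n) : Tm m n
  /-- first projection -/
  | fst {m n : ℕ} (e : Tm m n) : Tm m n
  /-- second projection -/
  | snd {m n : ℕ} (e : Tm m n) : Tm m n
  /-- `Λx. e`, binding a type variable -/
  | tlam {m n : ℕ} (e : Tm (m + 1) n) : Tm m n
  /-- `e[τ]` -/
  | tapp {m n : ℕ} (e : Tm m n) (τ : Ty m) : Tm m n
  /-- `pack [τ, e] as ∃x.τ'` -/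
  | pack {m n : ℕ} (τ : Ty m) (e : Tm m n) (τ' : Ty (m + 1)) : Tm m n
  /-- `open e₁ as [x, y] in e₂`, binding a type variable `x` and a term variable `y` in `e₂` -/
  | unpack {m n : ℕ} (e₁ : Tm m n) (e₂ : Tm (m + 1) (n + 1)) : Tm m n
  /-- `letcc[τ] x. e` -/
  | letcc {m n : ℕ} (τ : Ty m) (e : Tm m (n + 1)) : Tm m n
  /-- `throw e₁ to e₂` -/
  | throw {m n : ℕ} (e₁ e₂ : Tm m n) : Tm m n
  /-- `cont(E)` -/
  | cont {m n : ℕ} (E : ECtx m n) : Tm m n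

/-- Evaluation contexts, read from the outside in: `hole` is `[·]`, and for instance
`throwL E e₂` is `throw E to e₂`. The left components in `appR`, `pairR`, `throwR` are not forced
to be values by the grammar; the dynamics below only ever creates such contexts with values. -/
inductive ECtx : ℕ → ℕ → Type
  | hole {m n : ℕ} : ECtx m n
  | letIn {m n : ℕ} (E : ECtx m n) (e₂ : Tm m (n + 1)) : ECtx m n
  | abort {m n : ℕ} (τ : Ty m) (E : ECtx m n) : ECtx m n
  | appL {m n : ℕ} (E : ECtx m n) (e₂ : Tm m n) : ECtx m n
  | appR {m n : ℕ} (e₁ : Tm m n) (E : ECtx m n) : ECtx m n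
  | pairL {m n : ℕ} (E : ECtx m n) (e₂ : Tm m n) : ECtx m n
  | pairR {m n : ℕ} (e₁ : Tm m n) (E : ECtx m n) : ECtx m n
  | fst {m n : ℕ} (E : ECtx m n) : ECtx m n
  | snd {m n : ℕ} (E : ECtx m n) : ECtx m n
  | tapp {m n : ℕ} (E : ECtx m n) (τ : Ty m) : ECtx m n
  | pack {m n : ℕ} (τ : Ty m) (E : ECtx m n) (τ' : Ty (m + 1)) : ECtx m n
  | unpack {m n : ℕ} (E : ECtx m n) (e₂ : Tm (m + 1) (n + 1)) : ECtx m n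
  | throwL {m n : ℕ} (E : ECtx m n) (e₂ : Tm m n) : ECtx m n
  | throwR {m n : ℕ} (e₁ : Tm m n) (E : ECtx m n) : ECtx m n

end

/-! ### Renaming and simultaneous capture-avoiding substitution -/

/-- Extend a renaming under a binder. -/
def liftRen {k l : ℕ} (ρ : Fin k → Fin l) : Fin (k + 1) → Fin (l + 1) :=
  Fin.cases 0 (fun i => (ρ i).succ)

def Ty.rename {m m' : ℕ} (ρ : Fin m → Fin m') : Ty m → Ty m'
  | .var i => .var (ρ i)
  | .zero => .zero
  | .one => .one
  | .arr a b => .arr (a.rename ρ) (b.rename ρ)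
  | .prod a b => .prod (a.rename ρ) (b.rename ρ)
  | .all a => .all (a.rename (liftRen ρ))
  | .ex a => .ex (a.rename (liftRen ρ))
  | .cont a => .cont (a.rename ρ)

/-- Extend a type substitution under a type binder. -/
def liftTySub {m m' : ℕ} (θ : Fin m → Ty m') : Fin (m + 1) → Ty (m' + 1) :=
  Fin.cases (.var 0) (fun i => (θ i).rename Fin.succ)

def Ty.subst {m m' : ℕ} (θ : Fin m → Ty m') : Ty m → Ty m'
  | .var i => θ i
  | .zero => .zero
  | .one => .one
  | .arr a b => .arr (a.subst θ) (b.subst θ)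
  | .prod a b => .prod (a.subst θ) (b.subst θ)
  | .all a => .all (a.subst (liftTySub θ))
  | .ex a => .ex (a.subst (liftTySub θ))
  | .cont a => .cont (a.subst θ)

mutual

/-- Rename type variables along `ρ` and term variables along `ξ`. -/
def Tm.rename {m n m' n' : ℕ} (ρ : Fin m → Fin m') (ξ : Fin n → Fin n') : Tm m n → Tm m' n'
  | .var i => .var (ξ i)
  | .letIn e₁ e₂ => .letIn (e₁.rename ρ ξ) (e₂.rename ρ (liftRen ξ))
  | .abort τ e => .abort (τ.rename ρ) (e.rename ρ ξ)
  | .unit => .unit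
  | .fn τ₁ τ₂ e => .fn (τ₁.rename ρ) (τ₂.rename ρ) (e.rename ρ (liftRen (liftRen ξ)))
  | .app e₁ e₂ => .app (e₁.rename ρ ξ) (e₂.rename ρ ξ)
  | .pair e₁ e₂ => .pair (e₁.rename ρ ξ) (e₂.rename ρ ξ)
  | .fst e => .fst (e.rename ρ ξ)
  | .snd e => .snd (e.rename ρ ξ)
  | .tlam e => .tlam (e.rename (liftRen ρ) ξ)
  | .tapp e τ => .tapp (e.rename ρ ξ) (τ.rename ρ)
  | .pack τ e τ' => .pack (τ.rename ρ) (e.rename ρ ξ) (τ'.rename (liftRen ρ))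
  | .unpack e₁ e₂ => .unpack (e₁.rename ρ ξ) (e₂.rename (liftRen ρ) (liftRen ξ))
  | .letcc τ e => .letcc (τ.rename ρ) (e.rename ρ (liftRen ξ))
  | .throw e₁ e₂ => .throw (e₁.rename ρ ξ) (e₂.rename ρ ξ)
  | .cont E => .cont (E.rename ρ ξ)

def ECtx.rename {m n m' n' : ℕ} (ρ : Fin m → Fin m') (ξ : Fin n → Fin n') :
    ECtx m n → ECtx m' n'
  | .hole => .hole
  | .letIn E e₂ => .letIn (E.rename ρ ξ) (e₂.rename ρ (liftRen ξ))
  | .abort τ E => .abort (τ.rename ρ) (E.rename ρ ξ)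
  | .appL E e₂ => .appL (E.rename ρ ξ) (e₂.rename ρ ξ)
  | .appR e₁ E => .appR (e₁.rename ρ ξ) (E.rename ρ ξ)
  | .pairL E e₂ => .pairL (E.rename ρ ξ) (e₂.rename ρ ξ)
  | .pairR e₁ E => .pairR (e₁.rename ρ ξ) (E.rename ρ ξ)
  | .fst E => .fst (E.rename ρ ξ)
  | .snd E => .snd (E.rename ρ ξ)
  | .tapp E τ => .tapp (E.rename ρ ξ) (τ.rename ρ)
  | .pack τ E τ' => .pack (τ.rename ρ) (E.rename ρ ξ) (τ'.rename (liftRen ρ))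
  | .unpack E e₂ => .unpack (E.rename ρ ξ) (e₂.rename (liftRen ρ) (liftRen ξ))
  | .throwL E e₂ => .throwL (E.rename ρ ξ) (e₂.rename ρ ξ)
  | .throwR e₁ E => .throwR (e₁.rename ρ ξ) (E.rename ρ ξ)

end

/-- Extend a term substitution under a term binder. -/
def liftSub {m n n' : ℕ} (σ : Fin n → Tm m n') : Fin (n + 1) → Tm m (n' + 1) :=
  Fin.cases (.var 0) (fun i => (σ i).rename id Fin.succ)

/-- Push a term substitution under a type binder. -/
def shiftSub {m n n' : ℕ} (σ : Fin n → Tm m n') : Fin n → Tm (m + 1) n' :=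
  fun i => (σ i).rename Fin.succ id

mutual

/-- Substitute `θ` for the type variables and `σ` for the term variables. -/
def Tm.subst {m n m' n' : ℕ} (θ : Fin m → Ty m') (σ : Fin n → Tm m' n') : Tm m n → Tm m' n'
  | .var i => σ i
  | .letIn e₁ e₂ => .letIn (e₁.subst θ σ) (e₂.subst θ (liftSub σ))
  | .abort τ e => .abort (τ.subst θ) (e.subst θ σ)
  | .unit => .unit
  | .fn τ₁ τ₂ e => .fn (τ₁.subst θ) (τ₂.subst θ) (e.subst θ (liftSub (liftSub σ)))
  | .app e₁ e₂ => .app (e₁.subst θ σ) (e₂.subst θ σ)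
  | .pair e₁ e₂ => .pair (e₁.subst θ σ) (e₂.subst θ σ)
  | .fst e => .fst (e.subst θ σ)
  | .snd e => .snd (e.subst θ σ)
  | .tlam e => .tlam (e.subst (liftTySub θ) (shiftSub σ))
  | .tapp e τ => .tapp (e.subst θ σ) (τ.subst θ)
  | .pack τ e τ' => .pack (τ.subst θ) (e.subst θ σ) (τ'.subst (liftTySub θ))
  | .unpack e₁ e₂ => .unpack (e₁.subst θ σ) (e₂.subst (liftTySub θ) (liftSub (shiftSub σ)))
  | .letcc τ e => .letcc (τ.subst θ) (e.subst θ (liftSub σ))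
  | .throw e₁ e₂ => .throw (e₁.subst θ σ) (e₂.subst θ σ)
  | .cont E => .cont (E.subst θ σ)

def ECtx.subst {m n m' n' : ℕ} (θ : Fin m → Ty m') (σ : Fin n → Tm m' n') :
    ECtx m n → ECtx m' n'
  | .hole => .hole
  | .letIn E e₂ => .letIn (E.subst θ σ) (e₂.subst θ (liftSub σ))
  | .abort τ E => .abort (τ.subst θ) (E.subst θ σ)
  | .appL E e₂ => .appL (E.subst θ σ) (e₂.subst θ σ)
  | .appR e₁ E => .appR (e₁.subst θ σ) (E.subst θ σ)
  | .pairL E e₂ => .pairL (E.subst θ σ) (e₂.subst θ σ)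
  | .pairR e₁ E => .pairR (e₁.subst θ σ) (E.subst θ σ)
  | .fst E => .fst (E.subst θ σ)
  | .snd E => .snd (E.subst θ σ)
  | .tapp E τ => .tapp (E.subst θ σ) (τ.subst θ)
  | .pack τ E τ' => .pack (τ.subst θ) (E.subst θ σ) (τ'.subst (liftTySub θ))
  | .unpack E e₂ => .unpack (E.subst θ σ) (e₂.subst (liftTySub θ) (liftSub (shiftSub σ)))
  | .throwL E e₂ => .throwL (E.subst θ σ) (e₂.subst θ σ)
  | .throwR e₁ E => .throwR (e₁.subst θ σ) (E.subst θ σ)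

end

/-- `[a/x]e` for the last bound term variable `x` (index `0`). -/
def Tm.subst1 {m n : ℕ} (a : Tm m n) (e : Tm m (n + 1)) : Tm m n :=
  e.subst Ty.var (Fin.cases a Tm.var)

/-- `[b/f, a/x]e` where `f` has index `1` and `x` has index `0`. -/
def Tm.subst2 {m n : ℕ} (b a : Tm m n) (e : Tm m (n + 2)) : Tm m n :=
  e.subst Ty.var (Fin.cases a (Fin.cases b Tm.var))

/-- `[τ/x]e` for the last bound type variable `x`. -/
def Tm.substTy {m n : ℕ} (τ : Ty m) (e : Tm (m + 1) n) : Tm m n :=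
  e.subst (Fin.cases τ Ty.var) Tm.var

/-- `[τ/x, a/y]e` for the last bound type variable `x` and the last bound term variable `y`. -/
def Tm.substTyTm {m n : ℕ} (τ : Ty m) (a : Tm m n) (e : Tm (m + 1) (n + 1)) : Tm m n :=
  e.subst (Fin.cases τ Ty.var) (Fin.cases a Tm.var)

/-- `E[e]`. -/
def ECtx.plug {m n : ℕ} : ECtx m n → Tm m n → Tm m n
  | .hole, e => e
  | .letIn E e₂, e => .letIn (E.plug e) e₂
  | .abort τ E, e => .abort τ (E.plug e)
  | .appL E e₂, e => .app (E.plug e) e₂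
  | .appR e₁ E, e => .app e₁ (E.plug e)
  | .pairL E e₂, e => .pair (E.plug e) e₂
  | .pairR e₁ E, e => .pair e₁ (E.plug e)
  | .fst E, e => .fst (E.plug e)
  | .snd E, e => .snd (E.plug e)
  | .tapp E τ, e => .tapp (E.plug e) τ
  | .pack τ E τ', e => .pack τ (E.plug e) τ'
  | .unpack E e₂, e => .unpack (E.plug e) e₂
  | .throwL E e₂, e => .throw (E.plug e) e₂
  | .throwR e₁ E, e => .throw e₁ (E.plug e)

/-- `E[E']`, the context `E` with its hole filled by the context `E'`. -/
def ECtx.comp {m n : ℕ} : ECtx m n → ECtx m n → ECtx m n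
  | .hole, E' => E'
  | .letIn E e₂, E' => .letIn (E.comp E') e₂
  | .abort τ E, E' => .abort τ (E.comp E')
  | .appL E e₂, E' => .appL (E.comp E') e₂
  | .appR e₁ E, E' => .appR e₁ (E.comp E')
  | .pairL E e₂, E' => .pairL (E.comp E') e₂
  | .pairR e₁ E, E' => .pairR e₁ (E.comp E')
  | .fst E, E' => .fst (E.comp E')
  | .snd E, E' => .snd (E.comp E')
  | .tapp E τ, E' => .tapp (E.comp E') τ
  | .pack τ E τ', E' => .pack τ (E.comp E') τ'
  | .unpack E e₂, E' => .unpack (E.comp E') e₂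
  | .throwL E e₂, E' => .throwL (E.comp E') e₂
  | .throwR e₁ E, E' => .throwR e₁ (E.comp E')

/-! ### Dynamics -/

/-- `e val`, for closed terms. -/
inductive Val : Tm 0 0 → Prop
  | unit : Val .unit
  | fn (τ₁ τ₂ : Ty 0) (e : Tm 0 2) : Val (.fn τ₁ τ₂ e)
  | pair {e₁ e₂ : Tm 0 0} : Val e₁ → Val e₂ → Val (.pair e₁ e₂)
  | tlam (e : Tm 1 0) : Val (.tlam e)
  | pack (τ : Ty 0) {e : Tm 0 0} (τ' : Ty 1) : Val e → Val (.pack τ e τ')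
  | cont (E : ECtx 0 0) : Val (.cont E)

/-- The three-part stepping relation `E; e ⟼ e'`: the term `e` inside the evaluation context `E`
makes the whole program `E[e]` step to the whole program `e'`. -/
inductive Step : ECtx 0 0 → Tm 0 0 → Tm 0 0 → Prop
  | letIn_frame {E : ECtx 0 0} {e₁ : Tm 0 0} {e₂ : Tm 0 1} {e' : Tm 0 0} :
      Step (E.comp (.letIn .hole e₂)) e₁ e' → Step E (.letIn e₁ e₂) e'
  | letIn_red {E : ECtx 0 0} {e₁ : Tm 0 0} {e₂ : Tm 0 1} :
      Val e₁ → Step E (.letIn e₁ e₂) (E.plug (Tm.subst1 e₁ e₂))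
  | abort_frame {E : ECtx 0 0} {τ : Ty 0} {e e' : Tm 0 0} :
      Step (E.comp (.abort τ .hole)) e e' → Step E (.abort τ e) e'
  | app_left {E : ECtx 0 0} {e₁ e₂ e' : Tm 0 0} :
      Step (E.comp (.appL .hole e₂)) e₁ e' → Step E (.app e₁ e₂) e'
  | app_right {E : ECtx 0 0} {e₁ e₂ e' : Tm 0 0} :
      Val e₁ → Step (E.comp (.appR e₁ .hole)) e₂ e' → Step E (.app e₁ e₂) e'
  | app_red {E : ECtx 0 0} {τ₁ τ₂ : Ty 0} {e : Tm 0 2} {v : Tm 0 0} :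
      Val v → Step E (.app (.fn τ₁ τ₂ e) v) (E.plug (Tm.subst2 (.fn τ₁ τ₂ e) v e))
  | pair_left {E : ECtx 0 0} {e₁ e₂ e' : Tm 0 0} :
      Step (E.comp (.pairL .hole e₂)) e₁ e' → Step E (.pair e₁ e₂) e'
  | pair_right {E : ECtx 0 0} {e₁ e₂ e' : Tm 0 0} :
      Val e₁ → Step (E.comp (.pairR e₁ .hole)) e₂ e' → Step E (.pair e₁ e₂) e'
  | fst_frame {E : ECtx 0 0} {e e' : Tm 0 0} :
      Step (E.comp (.fst .hole)) e e' → Step E (.fst e) e'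
  | fst_red {E : ECtx 0 0} {v₁ v₂ : Tm 0 0} :
      Val v₁ → Val v₂ → Step E (.fst (.pair v₁ v₂)) (E.plug v₁)
  | snd_frame {E : ECtx 0 0} {e e' : Tm 0 0} :
      Step (E.comp (.snd .hole)) e e' → Step E (.snd e) e'
  | snd_red {E : ECtx 0 0} {v₁ v₂ : Tm 0 0} :
      Val v₁ → Val v₂ → Step E (.snd (.pair v₁ v₂)) (E.plug v₂)
  | tapp_frame {E : ECtx 0 0} {e : Tm 0 0} {τ : Ty 0} {e' : Tm 0 0} :
      Step (E.comp (.tapp .hole τ)) e e' → Step E (.tapp e τ) e'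
  | tapp_red {E : ECtx 0 0} {e : Tm 1 0} {τ : Ty 0} :
      Step E (.tapp (.tlam e) τ) (E.plug (Tm.substTy τ e))
  | pack_frame {E : ECtx 0 0} {τ : Ty 0} {e : Tm 0 0} {τ' : Ty 1} {e' : Tm 0 0} :
      Step (E.comp (.pack τ .hole τ')) e e' → Step E (.pack τ e τ') e'
  | unpack_frame {E : ECtx 0 0} {e₁ : Tm 0 0} {e₂ : Tm 1 1} {e' : Tm 0 0} :
      Step (E.comp (.unpack .hole e₂)) e₁ e' → Step E (.unpack e₁ e₂) e'
  | unpack_red {E : ECtx 0 0} {τ : Ty 0} {v : Tm 0 0} {τ' : Ty 1} {e₂ : Tm 1 1} :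
      Val v → Step E (.unpack (.pack τ v τ') e₂) (E.plug (Tm.substTyTm τ v e₂))
  | letcc_red {E : ECtx 0 0} {τ : Ty 0} {e : Tm 0 1} :
      Step E (.letcc τ e) (E.plug (Tm.subst1 (.cont E) e))
  | throw_left {E : ECtx 0 0} {e₁ e₂ e' : Tm 0 0} :
      Step (E.comp (.throwL .hole e₂)) e₁ e' → Step E (.throw e₁ e₂) e'
  | throw_right {E : ECtx 0 0} {e₁ e₂ e' : Tm 0 0} :
      Val e₁ → Step (E.comp (.throwR e₁ .hole)) e₂ e' → Step E (.throw e₁ e₂) e'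
  | throw_red {E E' : ECtx 0 0} {v : Tm 0 0} :
      Val v → Step E (.throw v (.cont E')) (E'.plug v)

/-- `e ⟼ⁿ e'`: `n` chained steps of whole programs, each of the form `[·]; e ⟼ e'`. -/
inductive Steps : ℕ → Tm 0 0 → Tm 0 0 → Prop
  | refl (e : Tm 0 0) : Steps 0 e e
  | head {n : ℕ} {e e' e'' : Tm 0 0} : Step .hole e e' → Steps n e' e'' → Steps (n + 1) e e''

/-- `e↓`. -/
def Terminates (e : Tm 0 0) : Prop :=
  ∃ (v : Tm 0 0) (n : ℕ), Steps n e v ∧ Val v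

/-! ### The recursive function and its unrollings -/

/-- `F_ω = fun f (x : τ₁) : τ₂. e_f`, closed. -/
def fOmega (τ₁ τ₂ : Ty 0) (ef : Tm 0 2) : Tm 0 0 := .fn τ₁ τ₂ ef

/-- `F₀ = fun g (y : τ₁) : τ₂. g y` and `F_{n+1} = fun _ (y : τ₁) : τ₂. [F_n/f, y/x]e_f`. -/
def unroll (τ₁ τ₂ : Ty 0) (ef : Tm 0 2) : ℕ → Tm 0 0
  | 0 => .fn τ₁ τ₂ (.app (.var 1) (.var 0))
  | n + 1 =>
      .fn τ₁ τ₂ (ef.subst Ty.var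
        (Fin.cases (.var 0) (fun _ => (unroll τ₁ τ₂ ef n).rename id Fin.elim0)))

end ContLang

namespace ContLang

-- A terminating run has finitely many steps, so it calls `F_ω` only finitely often, and a
-- sufficiently deep unrolling cannot be told apart from `F_ω` along it. The proof makes this a
-- simulation. Two programs are related when they agree except that some closed functions in one are
-- replaced by corresponding functions in the other. This is a congruence (`Tm.Rel`, `ECtx.Rel`)
-- rather than a single substitution instance, because a run makes copies of the function with
-- different unrolling depths, and `letcc` stores copies inside continuation values. For the same
-- reason the surrounding contexts must be related along with the terms.
--
-- The core is `Step.simulate`: a step on the left is matched by at most one step on the right,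
-- provided calls of the replaced functions are matched (`Unrolls`). Since a value is related only
-- to values (`Val.of_rel`), termination transfers from left to right (`Steps.terminates_of_rel`).
--
-- For the forward direction, `F_ω` is related to every unrolling of depth at least the number of
-- steps left; a call lowers the depth by at most one, and a step makes at most one call. For the
-- converse, every unrolling is related to `F_ω`. A call of `F_{k+1}` is matched by a call of `F_ω`;
-- a call of `F_0` just reproduces itself and is matched by not moving.

theorem liftRen_comp {a b c : ℕ} (ρ' : Fin b → Fin c) (ρ : Fin a → Fin b) :
    liftRen ρ' ∘ liftRen ρ = liftRen (ρ' ∘ ρ) := by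
  funext i; cases i using Fin.cases <;> rfl

theorem liftRen_comp_succ {a b : ℕ} (ρ : Fin a → Fin b) :
    liftRen ρ ∘ Fin.succ = Fin.succ ∘ ρ := by
  funext i; rfl

theorem liftRen_id {a : ℕ} : liftRen (id : Fin a → Fin a) = id := by
  funext i; cases i using Fin.cases <;> rfl

/-! ### Substitution lemmas for types -/

theorem Ty.rename_rename {m : ℕ} (τ : Ty m) : ∀ {m₁ m₂ : ℕ} (ρ : Fin m → Fin m₁)
    (ρ' : Fin m₁ → Fin m₂), (τ.rename ρ).rename ρ' = τ.rename (ρ' ∘ ρ) := by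
  induction τ <;> intros <;> simp [Ty.rename, liftRen_comp, *]

theorem liftTySub_comp_liftRen {a b c : ℕ} (θ : Fin b → Ty c) (ρ : Fin a → Fin b) :
    liftTySub θ ∘ liftRen ρ = liftTySub (θ ∘ ρ) := by
  funext i; cases i using Fin.cases <;> rfl

theorem Ty.subst_rename {m : ℕ} (τ : Ty m) : ∀ {m₁ m₂ : ℕ} (ρ : Fin m → Fin m₁)
    (θ : Fin m₁ → Ty m₂), (τ.rename ρ).subst θ = τ.subst (θ ∘ ρ) := by
  induction τ <;> intros <;> simp [Ty.rename, Ty.subst, liftTySub_comp_liftRen, *]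

theorem rename_comp_liftTySub {a b c : ℕ} (ρ : Fin b → Fin c) (θ : Fin a → Ty b) :
    Ty.rename (liftRen ρ) ∘ liftTySub θ = liftTySub (Ty.rename ρ ∘ θ) := by
  funext i
  cases i using Fin.cases <;>
    simp [liftTySub, Ty.rename, Ty.rename_rename, liftRen_comp_succ]
  rfl

theorem Ty.rename_subst {m : ℕ} (τ : Ty m) : ∀ {m₁ m₂ : ℕ} (θ : Fin m → Ty m₁)
    (ρ : Fin m₁ → Fin m₂), (τ.subst θ).rename ρ = τ.subst (Ty.rename ρ ∘ θ) := by
  induction τ <;> intros <;> simp [Ty.rename, Ty.subst, rename_comp_liftTySub, *]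

/-- Lifting renames the substituted types by `Fin.succ`, so fusing two substitutions under a binder
first needs the laws that fuse a substitution with a renaming on either side. The same order recurs
for terms. -/
theorem subst_comp_liftTySub {a b c : ℕ} (θ' : Fin b → Ty c) (θ : Fin a → Ty b) :
    Ty.subst (liftTySub θ') ∘ liftTySub θ = liftTySub (Ty.subst θ' ∘ θ) := by
  funext i
  cases i using Fin.cases <;>
    simp [liftTySub, Ty.subst, Ty.rename_subst, Ty.subst_rename]
  rfl

theorem Ty.subst_subst {m : ℕ} (τ : Ty m) : ∀ {m₁ m₂ : ℕ} (θ : Fin m → Ty m₁)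
    (θ' : Fin m₁ → Ty m₂), (τ.subst θ).subst θ' = τ.subst (Ty.subst θ' ∘ θ) := by
  induction τ <;> intros <;> simp [Ty.subst, subst_comp_liftTySub, *]

theorem liftTySub_var_comp {a b : ℕ} (ρ : Fin a → Fin b) :
    liftTySub (Ty.var ∘ ρ) = Ty.var ∘ liftRen ρ := by
  funext i; cases i using Fin.cases <;> rfl

theorem Ty.subst_var_comp {m : ℕ} (τ : Ty m) : ∀ {m₁ : ℕ} (ρ : Fin m → Fin m₁),
    τ.subst (Ty.var ∘ ρ) = τ.rename ρ := by
  induction τ <;> intros <;> simp [Ty.rename, Ty.subst, liftTySub_var_comp, *]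

theorem Ty.rename_id {m : ℕ} (τ : Ty m) : τ.rename id = τ := by
  induction τ <;> simp [Ty.rename, liftRen_id, *]

/-! ### Substitution lemmas for terms -/

theorem Tm.rename_id {m n : ℕ} (e : Tm m n) : e.rename id id = e := by
  induction e using Tm.rec (motive_2 := fun _ _ E => E.rename id id = E) <;>
    simp [Tm.rename, ECtx.rename, liftRen_id, Ty.rename_id, *]

theorem Tm.rename_rename {m n : ℕ} (e : Tm m n) : ∀ {m₁ m₂ n₁ n₂ : ℕ} (ρ : Fin m → Fin m₁)
    (ρ' : Fin m₁ → Fin m₂) (ξ : Fin n → Fin n₁) (ξ' : Fin n₁ → Fin n₂),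
    (e.rename ρ ξ).rename ρ' ξ' = e.rename (ρ' ∘ ρ) (ξ' ∘ ξ) := by
  induction e using Tm.rec (motive_2 := fun m n E => ∀ {m₁ m₂ n₁ n₂ : ℕ} (ρ : Fin m → Fin m₁)
    (ρ' : Fin m₁ → Fin m₂) (ξ : Fin n → Fin n₁) (ξ' : Fin n₁ → Fin n₂),
    (E.rename ρ ξ).rename ρ' ξ' = E.rename (ρ' ∘ ρ) (ξ' ∘ ξ)) <;> intros <;>
    simp [Tm.rename, ECtx.rename, liftRen_comp, Ty.rename_rename, *]

theorem liftSub_comp_liftRen {m a b c : ℕ} (σ : Fin b → Tm m c) (ξ : Fin a → Fin b) :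
    liftSub σ ∘ liftRen ξ = liftSub (σ ∘ ξ) := by
  funext i; cases i using Fin.cases <;> rfl

theorem shiftSub_comp {m a b c : ℕ} (σ : Fin b → Tm m c) (ξ : Fin a → Fin b) :
    shiftSub σ ∘ ξ = shiftSub (σ ∘ ξ) := rfl

theorem Tm.subst_rename {m n : ℕ} (e : Tm m n) : ∀ {m₁ m₂ n₁ n₂ : ℕ} (ρ : Fin m → Fin m₁)
    (θ : Fin m₁ → Ty m₂) (ξ : Fin n → Fin n₁) (σ : Fin n₁ → Tm m₂ n₂),
    (e.rename ρ ξ).subst θ σ = e.subst (θ ∘ ρ) (σ ∘ ξ) := by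
  induction e using Tm.rec (motive_2 := fun m n E => ∀ {m₁ m₂ n₁ n₂ : ℕ} (ρ : Fin m → Fin m₁)
    (θ : Fin m₁ → Ty m₂) (ξ : Fin n → Fin n₁) (σ : Fin n₁ → Tm m₂ n₂),
    (E.rename ρ ξ).subst θ σ = E.subst (θ ∘ ρ) (σ ∘ ξ)) <;> intros <;>
    simp [Tm.rename, ECtx.rename, Tm.subst, ECtx.subst, liftTySub_comp_liftRen,
      liftSub_comp_liftRen, shiftSub_comp, Ty.subst_rename, *]

theorem rename_comp_liftSub {m m' a b c : ℕ} (ρ : Fin m → Fin m') (ξ : Fin b → Fin c)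
    (σ : Fin a → Tm m b) :
    Tm.rename ρ (liftRen ξ) ∘ liftSub σ = liftSub (Tm.rename ρ ξ ∘ σ) := by
  funext i
  cases i using Fin.cases <;>
    simp [liftSub, Tm.rename, Tm.rename_rename, liftRen_comp_succ]
  rfl

theorem rename_comp_shiftSub {m m' a b c : ℕ} (ρ : Fin m → Fin m') (ξ : Fin b → Fin c)
    (σ : Fin a → Tm m b) :
    Tm.rename (liftRen ρ) ξ ∘ shiftSub σ = shiftSub (Tm.rename ρ ξ ∘ σ) := by
  funext i
  simp [shiftSub, Tm.rename_rename, liftRen_comp_succ]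

theorem Tm.rename_subst {m n : ℕ} (e : Tm m n) : ∀ {m₁ m₂ n₁ n₂ : ℕ} (θ : Fin m → Ty m₁)
    (ρ : Fin m₁ → Fin m₂) (σ : Fin n → Tm m₁ n₁) (ξ : Fin n₁ → Fin n₂),
    (e.subst θ σ).rename ρ ξ = e.subst (Ty.rename ρ ∘ θ) (Tm.rename ρ ξ ∘ σ) := by
  induction e using Tm.rec (motive_2 := fun m n E => ∀ {m₁ m₂ n₁ n₂ : ℕ} (θ : Fin m → Ty m₁)
    (ρ : Fin m₁ → Fin m₂) (σ : Fin n → Tm m₁ n₁) (ξ : Fin n₁ → Fin n₂),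
    (E.subst θ σ).rename ρ ξ = E.subst (Ty.rename ρ ∘ θ) (Tm.rename ρ ξ ∘ σ)) <;> intros <;>
    simp [Tm.rename, ECtx.rename, Tm.subst, ECtx.subst, rename_comp_liftTySub,
      rename_comp_liftSub, rename_comp_shiftSub, Ty.rename_subst, *]

theorem subst_comp_liftSub {m m' a b c : ℕ} (θ : Fin m → Ty m') (σ' : Fin b → Tm m' c)
    (σ : Fin a → Tm m b) :
    Tm.subst θ (liftSub σ') ∘ liftSub σ = liftSub (Tm.subst θ σ' ∘ σ) := by
  funext i
  cases i using Fin.cases with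
  | zero => rfl
  | succ i =>
    simp only [liftSub, Function.comp_apply, Fin.cases_succ, Tm.rename_subst, Tm.subst_rename]
    -- `liftSub` renames types by `id`, so what remains is to remove a trivial renaming from `θ`.
    congr 1
    funext j
    exact (Ty.rename_id _).symm

theorem subst_comp_shiftSub {m m' a b c : ℕ} (θ : Fin m → Ty m') (σ' : Fin b → Tm m' c)
    (σ : Fin a → Tm m b) :
    Tm.subst (liftTySub θ) (shiftSub σ') ∘ shiftSub σ = shiftSub (Tm.subst θ σ' ∘ σ) := by
  funext i
  simp only [shiftSub, Function.comp_apply, Tm.rename_subst, Tm.subst_rename]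
  rfl

theorem Tm.subst_subst {m n : ℕ} (e : Tm m n) : ∀ {m₁ m₂ n₁ n₂ : ℕ} (θ : Fin m → Ty m₁)
    (θ' : Fin m₁ → Ty m₂) (σ : Fin n → Tm m₁ n₁) (σ' : Fin n₁ → Tm m₂ n₂),
    (e.subst θ σ).subst θ' σ' = e.subst (Ty.subst θ' ∘ θ) (Tm.subst θ' σ' ∘ σ) := by
  induction e using Tm.rec (motive_2 := fun m n E => ∀ {m₁ m₂ n₁ n₂ : ℕ} (θ : Fin m → Ty m₁)
    (θ' : Fin m₁ → Ty m₂) (σ : Fin n → Tm m₁ n₁) (σ' : Fin n₁ → Tm m₂ n₂),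
    (E.subst θ σ).subst θ' σ' = E.subst (Ty.subst θ' ∘ θ) (Tm.subst θ' σ' ∘ σ)) <;> intros <;>
    simp [Tm.subst, ECtx.subst, subst_comp_liftTySub,
      subst_comp_liftSub, subst_comp_shiftSub, Ty.subst_subst, *]

theorem liftSub_var_comp {m a b : ℕ} (ξ : Fin a → Fin b) :
    liftSub (m := m) (Tm.var ∘ ξ) = Tm.var ∘ liftRen ξ := by
  funext i; cases i using Fin.cases <;> simp [liftSub, liftRen, Tm.rename]

theorem shiftSub_var_comp {m a b : ℕ} (ξ : Fin a → Fin b) :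
    shiftSub (m := m) (Tm.var ∘ ξ) = Tm.var ∘ ξ := by
  funext i; simp [shiftSub, Tm.rename]

theorem Tm.subst_var_comp {m n : ℕ} (e : Tm m n) : ∀ {m₁ n₁ : ℕ} (ρ : Fin m → Fin m₁)
    (ξ : Fin n → Fin n₁), e.subst (Ty.var ∘ ρ) (Tm.var ∘ ξ) = e.rename ρ ξ := by
  induction e using Tm.rec (motive_2 := fun m n E => ∀ {m₁ n₁ : ℕ} (ρ : Fin m → Fin m₁)
    (ξ : Fin n → Fin n₁), E.subst (Ty.var ∘ ρ) (Tm.var ∘ ξ) = E.rename ρ ξ) <;> intros <;>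
    simp [Tm.rename, ECtx.rename, Tm.subst, ECtx.subst, liftTySub_var_comp,
      liftSub_var_comp, shiftSub_var_comp, Ty.subst_var_comp, *]

/-! ### Closed terms in larger scopes -/

/-- A closed term, regarded as a term in an arbitrary scope. -/
def Tm.weaken {m n : ℕ} (e : Tm 0 0) : Tm m n := e.rename Fin.elim0 Fin.elim0

theorem Tm.weaken_self (e : Tm 0 0) : e.weaken = e := by
  rw [Tm.weaken, Subsingleton.elim (Fin.elim0 : Fin 0 → Fin 0) id, Tm.rename_id]

theorem Tm.rename_weaken {m n m' n' : ℕ} (e : Tm 0 0) (ρ : Fin m → Fin m')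
    (ξ : Fin n → Fin n') : e.weaken.rename ρ ξ = e.weaken := by
  rw [Tm.weaken, Tm.rename_rename, Tm.weaken]
  congr 1 <;> exact Subsingleton.elim _ _

/-- There is only one function out of `Fin 0`, so the substitution acts on a closed term like a
renaming into the larger scope. -/
theorem Tm.subst_weaken {m n m' n' : ℕ} (e : Tm 0 0) (θ : Fin m → Ty m')
    (σ : Fin n → Tm m' n') : e.weaken.subst θ σ = e.weaken := by
  rw [Tm.weaken, Tm.subst_rename, Tm.weaken, ← Tm.subst_var_comp]
  congr 1 <;> exact Subsingleton.elim _ _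

/-! ### Plugging and composing contexts -/

theorem ECtx.plug_comp {m n : ℕ} (E E' : ECtx m n) (e : Tm m n) :
    (E.comp E').plug e = E.plug (E'.plug e) := by
  induction E using ECtx.rec (motive_1 := fun _ _ _ => True) <;>
    simp_all [ECtx.comp, ECtx.plug]

/-! ### The congruence generated by a relation on closed functions -/

mutual

/-- The least congruence on terms which relates `f` and `g`, in every scope, whenever `f` and `g`
are closed functions with `B f g`. -/
inductive Tm.Rel (B : Tm 0 0 → Tm 0 0 → Prop) : {m n : ℕ} → Tm m n → Tm m n → Prop
  | var {m n : ℕ} (i : Fin n) : Tm.Rel B (.var i : Tm m n) (.var i)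
  | letIn {m n : ℕ} {e₁ e₁' : Tm m n} {e₂ e₂' : Tm m (n + 1)} :
      Tm.Rel B e₁ e₁' → Tm.Rel B e₂ e₂' → Tm.Rel B (.letIn e₁ e₂) (.letIn e₁' e₂')
  | abort {m n : ℕ} {τ : Ty m} {e e' : Tm m n} :
      Tm.Rel B e e' → Tm.Rel B (.abort τ e) (.abort τ e')
  | unit {m n : ℕ} : Tm.Rel B (.unit : Tm m n) .unit
  | fn {m n : ℕ} {τ₁ τ₂ : Ty m} {e e' : Tm m (n + 2)} :
      Tm.Rel B e e' → Tm.Rel B (.fn τ₁ τ₂ e) (.fn τ₁ τ₂ e')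
  | app {m n : ℕ} {e₁ e₁' e₂ e₂' : Tm m n} :
      Tm.Rel B e₁ e₁' → Tm.Rel B e₂ e₂' → Tm.Rel B (.app e₁ e₂) (.app e₁' e₂')
  | pair {m n : ℕ} {e₁ e₁' e₂ e₂' : Tm m n} :
      Tm.Rel B e₁ e₁' → Tm.Rel B e₂ e₂' → Tm.Rel B (.pair e₁ e₂) (.pair e₁' e₂')
  | fst {m n : ℕ} {e e' : Tm m n} : Tm.Rel B e e' → Tm.Rel B (.fst e) (.fst e')
  | snd {m n : ℕ} {e e' : Tm m n} : Tm.Rel B e e' → Tm.Rel B (.snd e) (.snd e')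
  | tlam {m n : ℕ} {e e' : Tm (m + 1) n} : Tm.Rel B e e' → Tm.Rel B (.tlam e) (.tlam e')
  | tapp {m n : ℕ} {e e' : Tm m n} {τ : Ty m} :
      Tm.Rel B e e' → Tm.Rel B (.tapp e τ) (.tapp e' τ)
  | pack {m n : ℕ} {τ : Ty m} {e e' : Tm m n} {τ' : Ty (m + 1)} :
      Tm.Rel B e e' → Tm.Rel B (.pack τ e τ') (.pack τ e' τ')
  | unpack {m n : ℕ} {e₁ e₁' : Tm m n} {e₂ e₂' : Tm (m + 1) (n + 1)} :
      Tm.Rel B e₁ e₁' → Tm.Rel B e₂ e₂' → Tm.Rel B (.unpack e₁ e₂) (.unpack e₁' e₂')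
  | letcc {m n : ℕ} {τ : Ty m} {e e' : Tm m (n + 1)} :
      Tm.Rel B e e' → Tm.Rel B (.letcc τ e) (.letcc τ e')
  | throw {m n : ℕ} {e₁ e₁' e₂ e₂' : Tm m n} :
      Tm.Rel B e₁ e₁' → Tm.Rel B e₂ e₂' → Tm.Rel B (.throw e₁ e₂) (.throw e₁' e₂')
  | cont {m n : ℕ} {E E' : ECtx m n} : ECtx.Rel B E E' → Tm.Rel B (.cont E) (.cont E')
  | base {m n : ℕ} {τ₁ τ₂ τ₁' τ₂' : Ty 0} {b b' : Tm 0 2} :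
      B (.fn τ₁ τ₂ b) (.fn τ₁' τ₂' b') →
      Tm.Rel B
        (.fn (τ₁.rename Fin.elim0) (τ₂.rename Fin.elim0)
          (b.rename Fin.elim0 (liftRen (liftRen Fin.elim0))) : Tm m n)
        (.fn (τ₁'.rename Fin.elim0) (τ₂'.rename Fin.elim0)
          (b'.rename Fin.elim0 (liftRen (liftRen Fin.elim0))))

/-- The extension of `Tm.Rel` to evaluation contexts. -/
inductive ECtx.Rel (B : Tm 0 0 → Tm 0 0 → Prop) : {m n : ℕ} → ECtx m n → ECtx m n → Prop
  | hole {m n : ℕ} : ECtx.Rel B (.hole : ECtx m n) .hole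
  | letIn {m n : ℕ} {E E' : ECtx m n} {e₂ e₂' : Tm m (n + 1)} :
      ECtx.Rel B E E' → Tm.Rel B e₂ e₂' → ECtx.Rel B (.letIn E e₂) (.letIn E' e₂')
  | abort {m n : ℕ} {τ : Ty m} {E E' : ECtx m n} :
      ECtx.Rel B E E' → ECtx.Rel B (.abort τ E) (.abort τ E')
  | appL {m n : ℕ} {E E' : ECtx m n} {e₂ e₂' : Tm m n} :
      ECtx.Rel B E E' → Tm.Rel B e₂ e₂' → ECtx.Rel B (.appL E e₂) (.appL E' e₂')
  | appR {m n : ℕ} {e₁ e₁' : Tm m n} {E E' : ECtx m n} :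
      Tm.Rel B e₁ e₁' → ECtx.Rel B E E' → ECtx.Rel B (.appR e₁ E) (.appR e₁' E')
  | pairL {m n : ℕ} {E E' : ECtx m n} {e₂ e₂' : Tm m n} :
      ECtx.Rel B E E' → Tm.Rel B e₂ e₂' → ECtx.Rel B (.pairL E e₂) (.pairL E' e₂')
  | pairR {m n : ℕ} {e₁ e₁' : Tm m n} {E E' : ECtx m n} :
      Tm.Rel B e₁ e₁' → ECtx.Rel B E E' → ECtx.Rel B (.pairR e₁ E) (.pairR e₁' E')
  | fst {m n : ℕ} {E E' : ECtx m n} : ECtx.Rel B E E' → ECtx.Rel B (.fst E) (.fst E')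
  | snd {m n : ℕ} {E E' : ECtx m n} : ECtx.Rel B E E' → ECtx.Rel B (.snd E) (.snd E')
  | tapp {m n : ℕ} {E E' : ECtx m n} {τ : Ty m} :
      ECtx.Rel B E E' → ECtx.Rel B (.tapp E τ) (.tapp E' τ)
  | pack {m n : ℕ} {τ : Ty m} {E E' : ECtx m n} {τ' : Ty (m + 1)} :
      ECtx.Rel B E E' → ECtx.Rel B (.pack τ E τ') (.pack τ E' τ')
  | unpack {m n : ℕ} {E E' : ECtx m n} {e₂ e₂' : Tm (m + 1) (n + 1)} :
      ECtx.Rel B E E' → Tm.Rel B e₂ e₂' → ECtx.Rel B (.unpack E e₂) (.unpack E' e₂')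
  | throwL {m n : ℕ} {E E' : ECtx m n} {e₂ e₂' : Tm m n} :
      ECtx.Rel B E E' → Tm.Rel B e₂ e₂' → ECtx.Rel B (.throwL E e₂) (.throwL E' e₂')
  | throwR {m n : ℕ} {e₁ e₁' : Tm m n} {E E' : ECtx m n} :
      Tm.Rel B e₁ e₁' → ECtx.Rel B E E' → ECtx.Rel B (.throwR e₁ E) (.throwR e₁' E')

end

-- Closure properties of the congruence

variable {B B' : Tm 0 0 → Tm 0 0 → Prop}

theorem Tm.Rel.refl {m n : ℕ} (e : Tm m n) : Tm.Rel B e e := by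
  induction e using Tm.rec (motive_2 := fun _ _ E => ECtx.Rel B E E) <;>
    constructor <;> assumption

theorem ECtx.Rel.refl {m n : ℕ} (E : ECtx m n) : ECtx.Rel B E E := by
  induction E using ECtx.rec (motive_1 := fun _ _ _ => True) <;>
    first | trivial | constructor <;> first | assumption | exact Tm.Rel.refl _

theorem Tm.Rel.mono (hB : ∀ f g, B f g → B' f g) {m n : ℕ} {e e' : Tm m n}
    (h : Tm.Rel B e e') : Tm.Rel B' e e' := by
  induction h using Tm.Rel.rec (motive_2 := fun E E' _ => ECtx.Rel B' E E') with
  | base h => exact .base (hB _ _ h)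
  | _ => constructor <;> assumption

/-- The generating pairs are functions, so continuation values are related only through their
contexts; this reduces the claim to terms. -/
theorem ECtx.Rel.mono (hB : ∀ f g, B f g → B' f g) {m n : ℕ} {E E' : ECtx m n}
    (h : ECtx.Rel B E E') : ECtx.Rel B' E E' := by
  cases (Tm.Rel.cont h).mono hB
  assumption

/-- The rule `base` spells out the weakened functions so that their head constructor is visible to
case analysis; this is the form in which renaming and substitution act trivially. -/
theorem Tm.Rel.weaken {m n : ℕ} {τ₁ τ₂ τ₁' τ₂' : Ty 0} {b b' : Tm 0 2}
    (h : B (.fn τ₁ τ₂ b) (.fn τ₁' τ₂' b')) :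
    Tm.Rel B ((Tm.fn τ₁ τ₂ b).weaken : Tm m n) ((Tm.fn τ₁' τ₂' b').weaken) := by
  simpa only [Tm.weaken, Tm.rename] using Tm.Rel.base h

theorem Tm.weaken_fn {m n : ℕ} (τ₁ τ₂ : Ty 0) (b : Tm 0 2) :
    (.fn (τ₁.rename Fin.elim0) (τ₂.rename Fin.elim0)
      (b.rename Fin.elim0 (liftRen (liftRen Fin.elim0))) : Tm m n) =
      (Tm.fn τ₁ τ₂ b).weaken := by
  simp only [Tm.weaken, Tm.rename]

theorem Tm.Rel.rename {m n : ℕ} {e e' : Tm m n} (h : Tm.Rel B e e') :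
    ∀ {m' n' : ℕ} (ρ : Fin m → Fin m') (ξ : Fin n → Fin n'),
      Tm.Rel B (e.rename ρ ξ) (e'.rename ρ ξ) := by
  induction h using Tm.Rel.rec (motive_2 := fun {m n} E E' _ =>
    ∀ {m' n' : ℕ} (ρ : Fin m → Fin m') (ξ : Fin n → Fin n'),
      ECtx.Rel B (E.rename ρ ξ) (E'.rename ρ ξ)) with
  | base h => intros; simpa only [Tm.weaken_fn, Tm.rename_weaken] using Tm.Rel.weaken h
  | _ => intros; simp only [Tm.rename, ECtx.rename]; constructor <;> apply_assumption

theorem Tm.Rel.liftSub {m a b : ℕ} {σ σ' : Fin a → Tm m b} (h : ∀ i, Tm.Rel B (σ i) (σ' i))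
    (i : Fin (a + 1)) : Tm.Rel B (liftSub σ i) (liftSub σ' i) := by
  cases i using Fin.cases with
  | zero => exact .var 0
  | succ i => exact (h i).rename _ _

theorem Tm.Rel.shiftSub {m a b : ℕ} {σ σ' : Fin a → Tm m b} (h : ∀ i, Tm.Rel B (σ i) (σ' i))
    (i : Fin a) : Tm.Rel B (shiftSub σ i) (shiftSub σ' i) :=
  (h i).rename _ _

theorem Tm.Rel.subst {m n : ℕ} {e e' : Tm m n} (h : Tm.Rel B e e') :
    ∀ {m' n' : ℕ} (θ : Fin m → Ty m') {σ σ' : Fin n → Tm m' n'},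
      (∀ i, Tm.Rel B (σ i) (σ' i)) → Tm.Rel B (e.subst θ σ) (e'.subst θ σ') := by
  induction h using Tm.Rel.rec (motive_2 := fun {m n} E E' _ =>
    ∀ {m' n' : ℕ} (θ : Fin m → Ty m') {σ σ' : Fin n → Tm m' n'},
      (∀ i, Tm.Rel B (σ i) (σ' i)) → ECtx.Rel B (E.subst θ σ) (E'.subst θ σ')) with
  -- The generating functions are closed, so the substitution leaves them alone.
  | base h => intros; simpa only [Tm.weaken_fn, Tm.subst_weaken] using Tm.Rel.weaken h
  | var i => intro _ _ _ _ _ h; simpa only [Tm.subst] using h i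
  | _ =>
    intros
    simp only [Tm.subst, ECtx.subst]
    constructor <;>
      solve_by_elim (maxDepth := 8) [Tm.Rel.liftSub, Tm.Rel.shiftSub]

theorem Tm.Rel.cases {m n : ℕ} {σ σ' : Fin n → Tm m 0} {a a' : Tm m 0} (h : Tm.Rel B a a')
    (hσ : ∀ i, Tm.Rel B (σ i) (σ' i)) (i : Fin (n + 1)) :
    Tm.Rel B (Fin.cases (motive := fun _ => Tm m 0) a σ i)
      (Fin.cases (motive := fun _ => Tm m 0) a' σ' i) := by
  cases i using Fin.cases with
  | zero => exact h
  | succ i => exact hσ i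

theorem ECtx.Rel.plug {m n : ℕ} {E E' : ECtx m n} (h : ECtx.Rel B E E') {e e' : Tm m n}
    (he : Tm.Rel B e e') : Tm.Rel B (E.plug e) (E'.plug e') := by
  induction h using ECtx.Rel.rec (motive_1 := fun _ _ _ => True) <;>
    first
    | trivial
    | (simp only [ECtx.plug]; first | exact he | (constructor <;> solve_by_elim))

theorem ECtx.Rel.comp {m n : ℕ} {E E' : ECtx m n} (h : ECtx.Rel B E E') {K K' : ECtx m n}
    (hK : ECtx.Rel B K K') : ECtx.Rel B (E.comp K) (E'.comp K') := by
  induction h using ECtx.Rel.rec (motive_1 := fun _ _ _ => True) <;>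
    first
    | trivial
    | (simp only [ECtx.comp]; first | exact hK | (constructor <;> solve_by_elim))

/-! ### Simulation -/

/-- Related closed terms have the same head constructor: `base` only replaces functions by
functions, which are values whatever their bodies. -/
theorem Val.of_rel {v v' : Tm 0 0} (hv : Val v) (h : Tm.Rel B v v') : Val v' := by
  induction hv generalizing v' with
  | unit => cases h; exact .unit
  | fn => cases h <;> exact .fn _ _ _
  | pair _ _ ih₁ ih₂ => cases h with | pair h₁ h₂ => exact .pair (ih₁ h₁) (ih₂ h₂)
  | tlam => cases h; exact .tlam _
  | pack _ _ _ ih => cases h with | pack h => exact .pack _ _ (ih h)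
  | cont => cases h; exact .cont _

/-- A closed function related to another one by `Tm.Rel` is obtained from it by relating the
bodies, unless the two are related by the generating relation. -/
theorem Tm.Rel.fn_inv {τ₁ τ₂ : Ty 0} {b : Tm 0 2} {t : Tm 0 0}
    (h : Tm.Rel B (.fn τ₁ τ₂ b) t) :
    (∃ b', t = .fn τ₁ τ₂ b' ∧ Tm.Rel B b b') ∨
      ∃ τ₁' τ₂' b', t = .fn τ₁' τ₂' b' ∧ B (.fn τ₁ τ₂ b) (.fn τ₁' τ₂' b') := by
  generalize hs : Tm.fn τ₁ τ₂ b = s at h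
  cases h with
  | fn h => cases hs; exact .inl ⟨_, rfl, h⟩
  | base h =>
    simp only [Tm.weaken_fn, Tm.weaken_self]
    exact .inr ⟨_, _, _, rfl, h⟩
  | _ => cases hs

/-- `B` unrolls into `B'`: one call of the left one of two functions related by `B` is matched, up
to `B'`, by at most one call of the right one. -/
def Unrolls (B B' : Tm 0 0 → Tm 0 0 → Prop) : Prop :=
  (∀ f g, B f g → B' f g) ∧
  ∀ τ₁ τ₂ b τ₁' τ₂' b', B (.fn τ₁ τ₂ b) (.fn τ₁' τ₂' b') → ∀ v v', Tm.Rel B v v' →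
    Tm.Rel B' (Tm.subst2 (.fn τ₁ τ₂ b) v b) (Tm.subst2 (.fn τ₁' τ₂' b') v' b') ∨
    Tm.Rel B' (Tm.subst2 (.fn τ₁ τ₂ b) v b) (.app (.fn τ₁' τ₂' b') v')

/-- Related programs have corresponding redexes in related contexts, so the same rule fires on both
sides, and the contractum is related by closure under substitution and plugging. Only a call of a
generating function can differ, and `Unrolls` covers it. The idle alternative speaks of the whole
program `E'.plug e'`, which makes it stable under moving a frame from the term into the context. -/
theorem Step.simulate (hB : Unrolls B B') {E : ECtx 0 0} {e r : Tm 0 0} (hs : Step E e r) :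
    ∀ {E' : ECtx 0 0} {e' : Tm 0 0}, ECtx.Rel B E E' → Tm.Rel B e e' →
      ∃ r', (Step E' e' r' ∨ E'.plug e' = r') ∧ Tm.Rel B' r r' := by
  -- The generic reduction, where both sides contract the same redex and return to their own
  -- contexts.
  have mk {E E' : ECtx 0 0} {e' s s' : Tm 0 0} (hE : ECtx.Rel B E E')
      (h : Step E' e' (E'.plug s')) (hr : Tm.Rel B s s') :
      ∃ r', (Step E' e' r' ∨ E'.plug e' = r') ∧ Tm.Rel B' (E.plug s) r' :=
    ⟨_, .inl h, (hE.plug hr).mono hB.1⟩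
  -- The search for a redex descends through a frame; idling is transported by associativity of
  -- plugging.
  have frame {E' K : ECtx 0 0} {e' r : Tm 0 0}
      (h : ∃ r', (Step (E'.comp K) e' r' ∨ (E'.comp K).plug e' = r') ∧ Tm.Rel B' r r')
      (hK : ∀ r', Step (E'.comp K) e' r' → Step E' (K.plug e') r') :
      ∃ r', (Step E' (K.plug e') r' ∨ E'.plug (K.plug e') = r') ∧ Tm.Rel B' r r' := by
    obtain ⟨r', h, hr⟩ := h
    exact ⟨r', h.imp (hK r') (fun h => by rwa [ECtx.plug_comp] at h), hr⟩
  have hole : ECtx.Rel B (.hole : ECtx 0 0) .hole := .hole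
  have var {n : ℕ} : ∀ i, Tm.Rel B (Tm.var i : Tm 0 n) (Tm.var i) := fun i => .var i
  induction hs with
  | letIn_frame _ ih =>
    intro E' e' hE he
    cases he with | letIn h₁ h₂ =>
    exact frame (ih (hE.comp (.letIn hole h₂)) h₁) fun _ => .letIn_frame
  | letIn_red hv =>
    intro E' e' hE he
    cases he with | letIn h₁ h₂ =>
    exact mk hE (.letIn_red (hv.of_rel h₁)) (h₂.subst _ (h₁.cases var))
  | abort_frame _ ih =>
    intro E' e' hE he
    cases he with | abort h =>
    exact frame (ih (hE.comp (.abort hole)) h) fun _ => .abort_frame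
  | app_left _ ih =>
    intro E' e' hE he
    cases he with | app h₁ h₂ =>
    exact frame (ih (hE.comp (.appL hole h₂)) h₁) fun _ => .app_left
  | app_right hv _ ih =>
    intro E' e' hE he
    cases he with | app h₁ h₂ =>
    exact frame (ih (hE.comp (.appR h₁ hole)) h₂) fun _ => .app_right (hv.of_rel h₁)
  | app_red hv =>
    intro E' e' hE he
    cases he with | app h₁ h₂ =>
    obtain ⟨b', rfl, hb⟩ | ⟨τ₁', τ₂', b', rfl, hb⟩ := h₁.fn_inv
    · exact mk hE (.app_red (hv.of_rel h₂)) (hb.subst _ (h₂.cases (h₁.cases var)))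
    -- The called function is a generating one: the right side either makes the matching call or
    -- waits.
    · obtain h | h := hB.2 _ _ _ _ _ _ hb _ _ h₂
      · exact ⟨_, .inl (.app_red (hv.of_rel h₂)), (hE.mono hB.1).plug h⟩
      · exact ⟨_, .inr rfl, (hE.mono hB.1).plug h⟩
  | pair_left _ ih =>
    intro E' e' hE he
    cases he with | pair h₁ h₂ =>
    exact frame (ih (hE.comp (.pairL hole h₂)) h₁) fun _ => .pair_left
  | pair_right hv _ ih =>
    intro E' e' hE he
    cases he with | pair h₁ h₂ =>
    exact frame (ih (hE.comp (.pairR h₁ hole)) h₂) fun _ => .pair_right (hv.of_rel h₁)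
  | fst_frame _ ih =>
    intro E' e' hE he
    cases he with | fst h =>
    exact frame (ih (hE.comp (.fst hole)) h) fun _ => .fst_frame
  | fst_red hv₁ hv₂ =>
    intro E' e' hE he
    cases he with | fst h =>
    cases h with | pair h₁ h₂ =>
    exact mk hE (.fst_red (hv₁.of_rel h₁) (hv₂.of_rel h₂)) h₁
  | snd_frame _ ih =>
    intro E' e' hE he
    cases he with | snd h =>
    exact frame (ih (hE.comp (.snd hole)) h) fun _ => .snd_frame
  | snd_red hv₁ hv₂ =>
    intro E' e' hE he
    cases he with | snd h =>
    cases h with | pair h₁ h₂ =>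
    exact mk hE (.snd_red (hv₁.of_rel h₁) (hv₂.of_rel h₂)) h₂
  | tapp_frame _ ih =>
    intro E' e' hE he
    cases he with | tapp h =>
    exact frame (ih (hE.comp (.tapp hole)) h) fun _ => .tapp_frame
  | tapp_red =>
    intro E' e' hE he
    cases he with | tapp h =>
    cases h with | tlam h =>
    exact mk hE .tapp_red (h.subst _ var)
  | pack_frame _ ih =>
    intro E' e' hE he
    cases he with | pack h =>
    exact frame (ih (hE.comp (.pack hole)) h) fun _ => .pack_frame
  | unpack_frame _ ih =>
    intro E' e' hE he
    cases he with | unpack h₁ h₂ =>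
    exact frame (ih (hE.comp (.unpack hole h₂)) h₁) fun _ => .unpack_frame
  | unpack_red hv =>
    intro E' e' hE he
    cases he with | unpack h₁ h₂ =>
    cases h₁ with | pack h₁ =>
    exact mk hE (.unpack_red (hv.of_rel h₁)) (h₂.subst _ (h₁.cases var))
  | letcc_red =>
    intro E' e' hE he
    cases he with | letcc h =>
    -- The captured contexts become part of the terms; their relation is exactly `hE`.
    exact mk hE .letcc_red (h.subst _ (Tm.Rel.cases (.cont hE) var))
  | throw_left _ ih =>
    intro E' e' hE he
    cases he with | throw h₁ h₂ =>
    exact frame (ih (hE.comp (.throwL hole h₂)) h₁) fun _ => .throw_left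
  | throw_right hv _ ih =>
    intro E' e' hE he
    cases he with | throw h₁ h₂ =>
    exact frame (ih (hE.comp (.throwR h₁ hole)) h₂) fun _ => .throw_right (hv.of_rel h₁)
  | throw_red hv =>
    intro E' e' hE he
    cases he with | throw h₁ h₂ =>
    cases h₂ with | cont h₂ =>
    -- The current contexts are discarded, so the thrown values are plugged into the related stored
    -- contexts instead.
    exact ⟨_, .inl (.throw_red (hv.of_rel h₁)), (h₂.plug h₁).mono hB.1⟩

/-- The index of `A` counts the steps the left run still has to make. The induction is on that run,
so idling on the right does no harm. -/
theorem Steps.terminates_of_rel {A : ℕ → Tm 0 0 → Tm 0 0 → Prop}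
    (hA : ∀ n, Unrolls (A (n + 1)) (A n)) {n : ℕ} {e v : Tm 0 0} (hs : Steps n e v)
    (hv : Val v) {e' : Tm 0 0} (h : Tm.Rel (A n) e e') : Terminates e' := by
  induction hs generalizing e' with
  | refl => exact ⟨e', 0, .refl _, hv.of_rel h⟩
  | head hs _ ih =>
    obtain ⟨r', hs' | rfl, hr⟩ := hs.simulate (hA _) .hole h
    · obtain ⟨w, k, hk, hw⟩ := ih hv hr
      exact ⟨w, k + 1, .head hs' hk, hw⟩
    · exact ih hv hr

/-! ### The recursive function and its unrollings -/

theorem unroll_eq_fn (τ₁ τ₂ : Ty 0) (ef : Tm 0 2) (n : ℕ) :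
    ∃ b, unroll τ₁ τ₂ ef n = .fn τ₁ τ₂ b := by
  cases n <;> exact ⟨_, by rw [unroll]⟩

/-- The body of an unrolling no longer mentions its own function variable, so the `f` supplied by
the call is lost, and `g` takes the place of the recursive function. -/
theorem subst2_unroll_body (f v g : Tm 0 0) (ef : Tm 0 2) :
    Tm.subst2 f v (ef.subst Ty.var (Fin.cases (.var 0) (fun _ => g.rename id Fin.elim0))) =
      Tm.subst2 g v ef := by
  rw [Tm.subst2, Tm.subst_subst, Tm.subst2]
  congr 1
  funext i
  match i with
  | 0 => rfl
  | 1 =>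
    change (g.rename id Fin.elim0).subst _ _ = g
    rw [Subsingleton.elim (id : Fin 0 → Fin 0) Fin.elim0]
    exact (Tm.subst_weaken g _ _).trans g.weaken_self

theorem Tm.Rel.subst2 {f f' v v' : Tm 0 0} (hf : Tm.Rel B f f') (hv : Tm.Rel B v v')
    (b : Tm 0 2) : Tm.Rel B (Tm.subst2 f v b) (Tm.subst2 f' v' b) :=
  (Tm.Rel.refl b).subst _ (hv.cases (hf.cases fun _ => .refl _))

theorem Tm.Rel.of_fn {τ₁ τ₂ τ₁' τ₂' : Ty 0} {b b' : Tm 0 2}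
    (h : B (.fn τ₁ τ₂ b) (.fn τ₁' τ₂' b')) : Tm.Rel B (.fn τ₁ τ₂ b) (.fn τ₁' τ₂' b') := by
  simpa only [Tm.weaken_self] using Tm.Rel.weaken (m := 0) (n := 0) h

-- The two relations between the recursive function and its unrollings

variable (τ₁ τ₂ : Ty 0) (ef : Tm 0 2)

/-- The recursive function below its unrollings of depth at least `n`. -/
def BelowUnroll (n : ℕ) (f g : Tm 0 0) : Prop :=
  f = fOmega τ₁ τ₂ ef ∧ ∃ k, n ≤ k ∧ g = unroll τ₁ τ₂ ef k

/-- The unrollings below the recursive function. -/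
def UnrollBelow (f g : Tm 0 0) : Prop :=
  (∃ k, f = unroll τ₁ τ₂ ef k) ∧ g = fOmega τ₁ τ₂ ef

variable {τ₁ τ₂ ef}

theorem rel_belowUnroll {n k : ℕ} (h : n ≤ k) :
    Tm.Rel (BelowUnroll τ₁ τ₂ ef n) (fOmega τ₁ τ₂ ef) (unroll τ₁ τ₂ ef k) := by
  obtain ⟨b, hb⟩ := unroll_eq_fn τ₁ τ₂ ef k
  rw [hb]
  exact .of_fn ⟨rfl, k, h, hb.symm⟩

theorem rel_unrollBelow (k : ℕ) :
    Tm.Rel (UnrollBelow τ₁ τ₂ ef) (unroll τ₁ τ₂ ef k) (fOmega τ₁ τ₂ ef) := by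
  obtain ⟨b, hb⟩ := unroll_eq_fn τ₁ τ₂ ef k
  rw [hb]
  exact .of_fn ⟨⟨k, hb.symm⟩, rfl⟩

theorem unrolls_belowUnroll (n : ℕ) :
    Unrolls (BelowUnroll τ₁ τ₂ ef (n + 1)) (BelowUnroll τ₁ τ₂ ef n) := by
  have hmono : ∀ f g, BelowUnroll τ₁ τ₂ ef (n + 1) f g → BelowUnroll τ₁ τ₂ ef n f g :=
    fun f g ⟨hf, k, hk, hg⟩ => ⟨hf, k, by omega, hg⟩
  refine ⟨hmono, ?_⟩
  rintro _ _ _ _ _ _ ⟨hf, k, hk, hg⟩ v v' hv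
  -- A step remains, so the depth is positive: `F_0` is never called here.
  obtain ⟨k, rfl⟩ : ∃ j, k = j + 1 := ⟨k - 1, by omega⟩
  cases hf
  rw [unroll] at hg
  cases hg
  left
  rw [subst2_unroll_body]
  exact .subst2 (rel_belowUnroll (by omega)) (hv.mono hmono) ef

theorem unrolls_unrollBelow : Unrolls (UnrollBelow τ₁ τ₂ ef) (UnrollBelow τ₁ τ₂ ef) := by
  refine ⟨fun _ _ h => h, ?_⟩
  rintro _ _ _ _ _ _ ⟨⟨k, hf⟩, hg⟩ v v' hv
  cases hg
  cases k with
  | zero =>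
    rw [unroll] at hf
    cases hf
    -- The body `g y` turns the call `F_0 v` into `F_0 v` again, so the right side stays at its own
    -- call of `F_ω`.
    right
    have h := rel_unrollBelow (τ₁ := τ₁) (τ₂ := τ₂) (ef := ef) 0
    rw [unroll] at h
    exact .app h hv
  | succ k =>
    rw [unroll] at hf
    cases hf
    left
    rw [subst2_unroll_body]
    exact .subst2 (rel_unrollBelow k) hv ef

end ContLang

-- Compactness

theorem mainTheorem1 (τ₁ τ₂ : ContLang.Ty 0) (ef : ContLang.Tm 0 2)
    (E : ContLang.ECtx 0 0) (e : ContLang.Tm 0 1) :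
    ContLang.Terminates (E.plug (ContLang.Tm.subst1 (ContLang.fOmega τ₁ τ₂ ef) e)) ↔
      ∃ n : ℕ, ContLang.Terminates
        (E.plug (ContLang.Tm.subst1 (ContLang.unroll τ₁ τ₂ ef n) e)) := by
  open ContLang in
  have rel {B : Tm 0 0 → Tm 0 0 → Prop} {f g : Tm 0 0} (h : Tm.Rel B f g) :
      Tm.Rel B (E.plug (Tm.subst1 f e)) (E.plug (Tm.subst1 g e)) :=
    (ECtx.Rel.refl E).plug ((Tm.Rel.refl e).subst _ (h.cases fun _ => .refl _))
  constructor
  · rintro ⟨v, n, hs, hv⟩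
    -- The length of the run serves as the unrolling depth.
    exact ⟨n, hs.terminates_of_rel unrolls_belowUnroll hv (rel (rel_belowUnroll le_rfl))⟩
  · rintro ⟨k, v, n, hs, hv⟩
    exact hs.terminates_of_rel (A := fun _ => UnrollBelow τ₁ τ₂ ef)
      (fun _ => unrolls_unrollBelow) hv (rel (rel_unrollBelow k))
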